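/- All graphs are finite and simple. Two edges are adjacent if they are distinct and share an endpoint. A set $D\subseteq E(G)$ is edge-dominating if every edge not in $D$ is adjacent to an edge of $D$. Two disjoint edge sets form an edge coalition if neither is edge-dominating but their union is. An $ec$-partition of $G$ is a partition $\pi$ of $E(G)$ such that each part either is a singleton edge-dominating set, or is not edge-dominating and forms an edge coalition with another part of $\pi$. The edge coalition number $EC(G)$ is the maximum number of parts of an $ec$-partition of $G$. A graph is unicyclic if it is connected and contains exactly one cycle. The star $K_{1,k}$ ($k\ge 1$) has a center adjacent to its $k$ leaves; the double star $S(p,q)$ ($p,q\ge 0$) consists of two stars with $p$ and $q$ leaves together with an edge joining their two centers. Let $\Theta$ be the family of all graphs isomorphic to one of the following: (a) a cycle $C_n$ with $3\le n\le 6$; (b) a graph obtained from $C_3$ by attaching at least one star, the center of each star being identified with some vertex of $C_3$; (c) a graph obtained from $C_3$ and a double star $S(p,0)$, $p\ge 0$, by identifying one vertex of $C_3$ with one of the two centers of the double star; (d) a graph obtained from $C_4$ by attaching one or two stars, the center of each star being identified with some vertex of $C_4$; (e) a graph obtained from $C_5$ by attaching one star, whose center is identified with a vertex of $C_5$. **Theorem.**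 Let $G$ be a unicyclic graph with $n$ vertices and $m$ edges. Then $n=m$, and $EC(G)=m$ if and only if $G\in\Theta$. Equivalently, the partition of $E(G)$ into singletons is an $ec$-partition of $G$ if and only if $G\in\Theta$. -/

import Mathlib

/-- Two edges are adjacent when they are distinct and have a common endpoint. -/
def EdgeAdj {V : Type*} (e f : Sym2 V) : Prop :=
  e ≠ f ∧ ∃ v, v ∈ e ∧ v ∈ f

/-- `D` is an edge-dominating set of `G`: a set of edges of `G` such that every edge outside `D`
is adjacent to some edge of `D`. -/
def IsEdgeDominating {V : Type*} (G : SimpleGraph V) (D : Finset (Sym2 V)) : Prop :=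
  (∀ e ∈ D, e ∈ G.edgeSet) ∧ ∀ e ∈ G.edgeSet, e ∉ D → ∃ f ∈ D, EdgeAdj e f

/-- `A` and `B` form an edge coalition of `G`: they are disjoint, neither is edge-dominating,
and their union is edge-dominating. -/
def IsEdgeCoalition {V : Type*} [DecidableEq V] (G : SimpleGraph V)
    (A B : Finset (Sym2 V)) : Prop :=
  Disjoint A B ∧ ¬ IsEdgeDominating G A ∧ ¬ IsEdgeDominating G B ∧ IsEdgeDominating G (A ∪ B)

/-- A partition of the edge set is an `ec`-partition when each part is a singleton edge-dominating
set, or is not edge-dominating and forms an edge coalition with another part. -/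
def IsECPartition {V : Type*} [Fintype V] [DecidableEq V] (G : SimpleGraph V)
    [DecidableRel G.Adj] (P : Finpartition G.edgeFinset) : Prop :=
  ∀ A ∈ P.parts,
    (A.card = 1 ∧ IsEdgeDominating G A) ∨
    (¬ IsEdgeDominating G A ∧ ∃ B ∈ P.parts, B ≠ A ∧ IsEdgeCoalition G A B)

/-- The edge coalition number `EC(G)`: the maximum number of parts of an `ec`-partition. -/
noncomputable def edgeCoalitionNumber {V : Type*} [Fintype V] [DecidableEq V]
    (G : SimpleGraph V) [DecidableRel G.Adj] : ℕ :=
  sSup {k | ∃ P : Finpartition G.edgeFinset, IsECPartition G P ∧ P.parts.card = k}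

/-- The partition of the edge set into singletons. -/
def singletonEdgePartition {V : Type*} [Fintype V] [DecidableEq V] (G : SimpleGraph V)
    [DecidableRel G.Adj] : Finpartition G.edgeFinset := ⊥

theorem singletonEdgePartition_parts {V : Type*} [Fintype V] [DecidableEq V]
    (G : SimpleGraph V) [DecidableRel G.Adj] :
    (singletonEdgePartition G).parts = G.edgeFinset.image (fun e => {e}) := by
  ext A
  simp [singletonEdgePartition]

/-- A unicyclic graph: connected, with exactly one cycle (cycles being counted as subgraphs). -/
def IsUnicyclic {V : Type*} (G : SimpleGraph V) : Prop :=
  G.Connected ∧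
    ∃! C : G.Subgraph, ∃ (u : V) (p : G.Walk u u), p.IsCycle ∧ p.toSubgraph = C

/-- The graph obtained from `H` by attaching, at each vertex `a`, a star with `k a` leaves whose
center is identified with `a` (nothing is attached at `a` if `k a = 0`). -/
def attachStars {α : Type*} (H : SimpleGraph α) (k : α → ℕ) :
    SimpleGraph (α ⊕ (Σ a : α, Fin (k a))) where
  Adj
    | Sum.inl a, Sum.inl b => H.Adj a b
    | Sum.inl a, Sum.inr x => x.1 = a
    | Sum.inr x, Sum.inl a => x.1 = a
    | Sum.inr _, Sum.inr _ => False
  symm := ⟨by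
    rintro (a | x) (b | y) h
    · exact SimpleGraph.Adj.symm (G := H) h
    · exact h
    · exact h
    · exact h⟩
  loopless := ⟨by
    rintro (a | x) h
    · exact H.loopless.irrefl a h
    · exact h⟩

/-- The double star `S(p, q)`: two stars with `p` and `q` leaves and an edge joining their
centers, which are the vertices `Sum.inl 0` and `Sum.inl 1`. -/
def doubleStar (p q : ℕ) : SimpleGraph (Fin 2 ⊕ (Σ i : Fin 2, Fin (![p, q] i))) :=
  attachStars (⊤ : SimpleGraph (Fin 2)) ![p, q]

/-- The graph obtained from disjoint copies of `H` and `K` by identifying the vertex `a` of `H`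
with the vertex `b` of `K`; the merged vertex is `Sum.inl a`. -/
def identifyVertices {α β : Type*} (H : SimpleGraph α) (a : α) (K : SimpleGraph β) (b : β) :
    SimpleGraph (α ⊕ {y : β // y ≠ b}) where
  Adj
    | Sum.inl x, Sum.inl y => H.Adj x y
    | Sum.inl x, Sum.inr y => x = a ∧ K.Adj b y
    | Sum.inr y, Sum.inl x => x = a ∧ K.Adj b y
    | Sum.inr x, Sum.inr y => K.Adj x y
  symm := ⟨by
    rintro (x | x) (y | y) h
    · exact SimpleGraph.Adj.symm (G := H) h
    · exact h
    · exact h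
    · exact SimpleGraph.Adj.symm (G := K) h⟩
  loopless := ⟨by
    rintro (x | x) h
    · exact H.loopless.irrefl x h
    · exact K.loopless.irrefl _ h⟩

/-- The number of vertices at which `attachStars` attaches a star. -/
def numAttached {n : ℕ} (k : Fin n → ℕ) : ℕ :=
  (Finset.univ.filter fun i => k i ≠ 0).card

/-- Membership of `G` in the family `Θ`, up to isomorphism. -/
def InTheta {V : Type*} (G : SimpleGraph V) : Prop :=
  -- (a) the cycles with three to six vertices
  (∃ n : ℕ, 3 ≤ n ∧ n ≤ 6 ∧ Nonempty (G ≃g SimpleGraph.cycleGraph n)) ∨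
  -- (b) a triangle with at least one star attached by its center
  (∃ k : Fin 3 → ℕ, 1 ≤ numAttached k ∧
    Nonempty (G ≃g attachStars (SimpleGraph.cycleGraph 3) k)) ∨
  -- (c) a triangle with a double star `S(p, 0)` attached by one of its two centers
  (∃ (p : ℕ) (v : Fin 3) (c : Fin 2),
    Nonempty (G ≃g
      identifyVertices (SimpleGraph.cycleGraph 3) v (doubleStar p 0) (Sum.inl c))) ∨
  -- (d) a four-cycle with one or two stars attached by their centers
  (∃ k : Fin 4 → ℕ, (numAttached k = 1 ∨ numAttached k = 2) ∧
    Nonempty (G ≃g attachStars (SimpleGraph.cycleGraph 4) k)) ∨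
  -- (e) a five-cycle with one star attached by its center
  (∃ k : Fin 5 → ℕ, numAttached k = 1 ∧
    Nonempty (G ≃g attachStars (SimpleGraph.cycleGraph 5) k))

/-! A set of edges is edge-dominating exactly when its endpoints form a vertex cover. So the
singleton partition is an ec-partition iff every edge covers alone or together with a non-covering
edge (`isECPartition_singleton_iff`). As it is the only partition with m parts, it also decides
whether EC(G) = m.

This covering condition ignores how many leaves hang at a vertex. For a core with leaves attached it
depends only on the core and on the set of core vertices that carry leaves
(`IsLeafExtension.edgePairCondition_iff`), so each small core is settled by a finite check.

The core is bounded by `EdgePairCondition.exists_adj`: among three pairwise disjoint edges, any two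
are joined by an edge. In a unicyclic graph every edge off the cycle is a bridge, so few joining
edges exist. This excludes cycles of length at least 7, and vertices at distance two from a cycle of
length at least 4. For a triangle with such a vertex, only the paw with leaves at its pendant vertex
survives, which is family (c). -/

/-! ### Edge coalitions as vertex covers -/

/-- Every edge `uv` of `G` covers all edges, or covers them together with another edge `u'v'` that
does not cover them all by itself. -/
def EdgePairCondition {V : Type*} (G : SimpleGraph V) : Prop :=
  ∀ u v, G.Adj u v → G.IsVertexCover {u, v} ∨
    ∃ u' v', G.Adj u' v' ∧ ¬ G.IsVertexCover {u', v'} ∧ G.IsVertexCover {u, v, u', v'}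

theorem isEdgeDominating_iff {V : Type*} {G : SimpleGraph V} {D : Finset (Sym2 V)}
    (hD : ∀ e ∈ D, e ∈ G.edgeSet) :
    IsEdgeDominating G D ↔ G.IsVertexCover {x | ∃ e ∈ D, x ∈ e} := by
  constructor
  · intro h v w hvw
    by_cases hm : s(v, w) ∈ D
    · exact Or.inl ⟨_, hm, Sym2.mem_mk_left v w⟩
    · obtain ⟨f, hf, -, x, hx, hxf⟩ := h.2 _ hvw hm
      rcases Sym2.mem_iff.1 hx with rfl | rfl
      · exact Or.inl ⟨f, hf, hxf⟩
      · exact Or.inr ⟨f, hf, hxf⟩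
  · refine fun h => ⟨hD, fun e he hne => ?_⟩
    induction e with | h v w
    rcases h he with ⟨f, hf, hv⟩ | ⟨f, hf, hv⟩
    · exact ⟨f, hf, fun h => hne (h ▸ hf), v, Sym2.mem_mk_left v w, hv⟩
    · exact ⟨f, hf, fun h => hne (h ▸ hf), w, Sym2.mem_mk_right v w, hv⟩

theorem isEdgeDominating_singleton_iff {V : Type*} {G : SimpleGraph V} {u v : V}
    (h : G.Adj u v) : IsEdgeDominating G {s(u, v)} ↔ G.IsVertexCover {u, v} := by
  rw [isEdgeDominating_iff (by simpa using h)]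
  congr! 1
  ext x
  simp

theorem isEdgeDominating_pair_iff {V : Type*} [DecidableEq V] {G : SimpleGraph V} {u v u' v' : V}
    (h : G.Adj u v) (h' : G.Adj u' v') :
    IsEdgeDominating G ({s(u, v)} ∪ {s(u', v')}) ↔ G.IsVertexCover {u, v, u', v'} := by
  rw [isEdgeDominating_iff (by
    intro e he
    rcases Finset.mem_union.1 he with he | he <;> rw [Finset.mem_singleton.1 he] <;> assumption)]
  congr! 1
  ext x
  simp [or_assoc]

theorem isECPartition_singleton_iff {V : Type*} [Fintype V] [DecidableEq V] (G : SimpleGraph V)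
    [DecidableRel G.Adj] :
    IsECPartition G (singletonEdgePartition G) ↔ EdgePairCondition G := by
  unfold IsECPartition
  simp only [singletonEdgePartition_parts, Finset.forall_mem_image, Finset.exists_mem_image,
    SimpleGraph.mem_edgeFinset, Finset.card_singleton, true_and]
  constructor
  · intro h u v huv
    rcases h (show s(u, v) ∈ G.edgeSet from huv) with h | ⟨-, f, hf, -, -, -, h1, h2⟩
    · exact Or.inl ((isEdgeDominating_singleton_iff huv).1 h)
    · induction f with | h u' v'
      exact Or.inr ⟨u', v', hf, fun h => h1 ((isEdgeDominating_singleton_iff hf).2 h),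
        (isEdgeDominating_pair_iff huv hf).1 h2⟩
  · intro h e he
    induction e with | h u v
    by_cases hd : IsEdgeDominating G {s(u, v)}
    · exact Or.inl hd
    · rcases h u v he with h | ⟨u', v', h', hn, hp⟩
      · exact absurd ((isEdgeDominating_singleton_iff he).2 h) hd
      · have hp' := (isEdgeDominating_pair_iff he h').2 hp
        -- The covering condition does not ask for distinct edges; this is automatic, since a
        -- repeated edge would dominate alone, against `hd`.
        have hne : ({s(u', v')} : Finset (Sym2 V)) ≠ {s(u, v)} := by
          intro heq
          rw [heq, Finset.union_self] at hp'
          exact hd hp'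
        exact Or.inr ⟨hd, s(u', v'), h', hne, Finset.disjoint_singleton_left.2 (by
          rw [Finset.mem_singleton]; rintro heq; exact hne (by rw [heq])), hd,
          fun h => hn ((isEdgeDominating_singleton_iff h').1 h), hp'⟩

/-- Part sizes are at least 1 and sum to the number of parts, so all equal 1. -/
theorem Finpartition.eq_bot_of_card_parts_eq {α : Type*} [DecidableEq α] {s : Finset α}
    (P : Finpartition s) (h : P.parts.card = s.card) : P = ⊥ := by
  have hsum := P.sum_card_parts
  have h1 : ∀ A ∈ P.parts, 1 ≤ A.card := fun A hA => (P.nonempty_of_mem_parts hA).card_pos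
  have h2 : ∀ A ∈ P.parts, 1 = A.card := by
    refine (Finset.sum_eq_sum_iff_of_le h1).1 ?_
    rw [hsum, ← h]
    simp
  refine le_bot_iff.1 fun A hA => ?_
  obtain ⟨a, rfl⟩ := Finset.card_eq_one.1 (h2 A hA).symm
  exact ⟨{a}, by simpa using P.le hA, le_rfl⟩

theorem edgeCoalitionNumber_eq_iff {V : Type*} [Fintype V] [DecidableEq V] (G : SimpleGraph V)
    [DecidableRel G.Adj] (hpos : 0 < G.edgeFinset.card) :
    edgeCoalitionNumber G = G.edgeFinset.card ↔ IsECPartition G (singletonEdgePartition G) := by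
  have hbdd : ∀ k ∈ {k | ∃ P : Finpartition G.edgeFinset, IsECPartition G P ∧ P.parts.card = k},
      k ≤ G.edgeFinset.card := by
    rintro k ⟨P, -, rfl⟩
    exact P.card_parts_le_card
  constructor
  · intro h
    have hne : {k | ∃ P : Finpartition G.edgeFinset,
        IsECPartition G P ∧ P.parts.card = k}.Nonempty := by
      by_contra hempty
      rw [Set.not_nonempty_iff_eq_empty] at hempty
      -- The supremum of the empty set is 0, which `hpos` excludes.
      rw [edgeCoalitionNumber, hempty, csSup_empty] at h
      exact hpos.ne h
    obtain ⟨P, hP, hc⟩ := Nat.sSup_mem hne ⟨_, hbdd⟩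
    rw [P.eq_bot_of_card_parts_eq (hc.trans h)] at hP
    exact hP
  · intro h
    exact IsGreatest.csSup_eq ⟨⟨_, h, Finpartition.card_bot _⟩, hbdd⟩

/-! ### Reduction to a core with leaves -/

/-- `c` embeds `K` as an induced subgraph of `G`, and every other vertex of `G` is a leaf attached
to the image of a vertex in `S`, each of which carries such a leaf. -/
structure IsLeafExtension {V ι : Type*} (G : SimpleGraph V) (K : SimpleGraph ι) (c : ι → V)
    (S : ι → Prop) : Prop where
  injective : Function.Injective c
  adj_iff : ∀ i j, G.Adj (c i) (c j) ↔ K.Adj i j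
  leaf : ∀ x, x ∉ Set.range c → ∃ i, S i ∧ ∀ y, G.Adj x y ↔ y = c i
  exists_leaf : ∀ i, S i → ∃ x, x ∉ Set.range c ∧ G.Adj x (c i)

/-- `T` contains `S` and is a vertex cover of `K`. -/
def CoversCore {ι : Type*} (K : SimpleGraph ι) (S : ι → Prop) (T : Finset ι) : Prop :=
  (∀ i, S i → i ∈ T) ∧ ∀ i j, K.Adj i j → i ∈ T ∨ j ∈ T

/-- The pair `i, j` is an edge of `K`, or stands for a leaf edge at `i = j`. -/
def CoreEdge {ι : Type*} (K : SimpleGraph ι) (S : ι → Prop) (i j : ι) : Prop :=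
  K.Adj i j ∨ (i = j ∧ S i)

/-- The condition on `K` and `S` that expresses `EdgePairCondition` for the graphs obtained from `K`
by attaching leaves at the vertices in `S`. -/
def CoreCondition {ι : Type*} [DecidableEq ι] (K : SimpleGraph ι) (S : ι → Prop) : Prop :=
  ∀ i j, CoreEdge K S i j → CoversCore K S {i, j} ∨
    ∃ i' j', CoreEdge K S i' j' ∧ ¬ CoversCore K S {i', j'} ∧ CoversCore K S {i, j, i', j'}

instance {ι : Type*} [Fintype ι] [DecidableEq ι] (K : SimpleGraph ι) [DecidableRel K.Adj]
    (S : ι → Prop) [DecidablePred S] (T : Finset ι) : Decidable (CoversCore K S T) := by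
  unfold CoversCore; infer_instance

instance {ι : Type*} [DecidableEq ι] (K : SimpleGraph ι) [DecidableRel K.Adj]
    (S : ι → Prop) [DecidablePred S] (i j : ι) : Decidable (CoreEdge K S i j) := by
  unfold CoreEdge; infer_instance

instance {ι : Type*} [Fintype ι] [DecidableEq ι] (K : SimpleGraph ι) [DecidableRel K.Adj]
    (S : ι → Prop) [DecidablePred S] : Decidable (CoreCondition K S) := by
  unfold CoreCondition; infer_instance

namespace IsLeafExtension

variable {V ι : Type*} {G : SimpleGraph V} {K : SimpleGraph ι} {c : ι → V} {S : ι → Prop}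

/-- By `hA`, a leaf in `A` brings its only neighbour into `A`. Hence a leaf edge is covered iff its
core end is in `A`, and only the trace of `A` on the core matters. -/
theorem isVertexCover_iff (h : IsLeafExtension G K c S) {A : Set V} {T : Finset ι}
    (hA : ∀ x ∈ A, ∃ y ∈ A, G.Adj x y) (hT : ∀ i, c i ∈ A ↔ i ∈ T) :
    G.IsVertexCover A ↔ CoversCore K S T := by
  constructor
  · refine fun hc => ⟨fun i hi => ?_, fun i j hij => ?_⟩
    · obtain ⟨x, hx, hxi⟩ := h.exists_leaf i hi
      rw [← hT]
      rcases hc hxi with hxA | hiA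
      · obtain ⟨y, hy, hxy⟩ := hA x hxA
        obtain ⟨l, -, hl⟩ := h.leaf x hx
        rwa [(hl _).1 hxi, ← (hl _).1 hxy]
      · exact hiA
    · rw [← hT, ← hT]
      exact hc ((h.adj_iff i j).2 hij)
  · have key : ∀ u v, G.Adj u v → u ∉ Set.range c → CoversCore K S T → v ∈ A := by
      intro u v huv hu hc
      obtain ⟨i, hi, hui⟩ := h.leaf u hu
      rw [(hui v).1 huv, hT]
      exact hc.1 i hi
    intro hc u v huv
    by_cases hu : u ∈ Set.range c
    · by_cases hv : v ∈ Set.range c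
      · obtain ⟨i, rfl⟩ := hu
        obtain ⟨j, rfl⟩ := hv
        simp only [hT]
        exact hc.2 i j ((h.adj_iff i j).1 huv)
      · exact Or.inl (key v u huv.symm hv hc)
    · exact Or.inr (key u v huv hu hc)

theorem exists_coreEdge (h : IsLeafExtension G K c S) {u v : V} (huv : G.Adj u v) :
    ∃ i j, CoreEdge K S i j ∧ ∀ l, (c l = u ∨ c l = v) ↔ (l = i ∨ l = j) := by
  have key : ∀ u v, G.Adj u v → u ∉ Set.range c →
      ∃ i j, CoreEdge K S i j ∧ ∀ l, (c l = u ∨ c l = v) ↔ (l = i ∨ l = j) := by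
    intro u v huv hu
    obtain ⟨i, hi, hui⟩ := h.leaf u hu
    refine ⟨i, i, Or.inr ⟨rfl, hi⟩, fun l => ?_⟩
    rw [(hui v).1 huv, h.injective.eq_iff, or_self, or_iff_right]
    exact fun hl => hu ⟨l, hl⟩
  by_cases hu : u ∈ Set.range c
  · by_cases hv : v ∈ Set.range c
    · obtain ⟨i, rfl⟩ := hu
      obtain ⟨j, rfl⟩ := hv
      exact ⟨i, j, Or.inl ((h.adj_iff i j).1 huv), fun l => by simp [h.injective.eq_iff]⟩
    · obtain ⟨i, j, hij, hl⟩ := key v u huv.symm hv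
      exact ⟨i, j, hij, fun l => or_comm.trans (hl l)⟩
  · exact key u v huv hu

theorem exists_edge (h : IsLeafExtension G K c S) {i j : ι} (hij : CoreEdge K S i j) :
    ∃ u v, G.Adj u v ∧ ∀ l, (c l = u ∨ c l = v) ↔ (l = i ∨ l = j) := by
  rcases hij with hij | ⟨rfl, hi⟩
  · exact ⟨c i, c j, (h.adj_iff i j).2 hij, fun l => by simp [h.injective.eq_iff]⟩
  · obtain ⟨x, hx, hxi⟩ := h.exists_leaf i hi
    refine ⟨x, c i, hxi, fun l => ?_⟩
    rw [h.injective.eq_iff, or_self, or_iff_right]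
    exact fun hl => hx ⟨l, hl⟩

/-- Edges and core edges correspond with the same trace on the core, a leaf edge at `i` becoming the
pair `i, i`; covering is read off from that trace. -/
theorem edgePairCondition_iff [DecidableEq ι] (h : IsLeafExtension G K c S) :
    EdgePairCondition G ↔ CoreCondition K S := by
  have one : ∀ {u v i j}, G.Adj u v → (∀ l, (c l = u ∨ c l = v) ↔ (l = i ∨ l = j)) →
      (G.IsVertexCover {u, v} ↔ CoversCore K S {i, j}) := by
    intro u v i j huv hl
    refine h.isVertexCover_iff ?_ (by simpa using hl)
    rintro x (rfl | rfl)
    · exact ⟨v, by simp, huv⟩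
    · exact ⟨u, by simp, huv.symm⟩
  have two : ∀ {u v u' v' i j i' j'}, G.Adj u v → G.Adj u' v' →
      (∀ l, (c l = u ∨ c l = v) ↔ (l = i ∨ l = j)) →
      (∀ l, (c l = u' ∨ c l = v') ↔ (l = i' ∨ l = j')) →
      (G.IsVertexCover {u, v, u', v'} ↔ CoversCore K S {i, j, i', j'}) := by
    intro u v u' v' i j i' j' huv huv' hl hl'
    refine h.isVertexCover_iff ?_ fun l => ?_
    · rintro x (rfl | rfl | rfl | rfl)
      · exact ⟨v, by simp, huv⟩
      · exact ⟨u, by simp, huv.symm⟩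
      · exact ⟨v', by simp, huv'⟩
      · exact ⟨u', by simp, huv'.symm⟩
    · have h1 := hl l
      have h2 := hl' l
      simp only [Set.mem_insert_iff, Set.mem_singleton_iff, Finset.mem_insert,
        Finset.mem_singleton]
      tauto
  constructor
  · intro hG i j hij
    obtain ⟨u, v, huv, hl⟩ := h.exists_edge hij
    rcases hG u v huv with hc | ⟨u', v', huv', hn, hc⟩
    · exact Or.inl ((one huv hl).1 hc)
    · obtain ⟨i', j', hij', hl'⟩ := h.exists_coreEdge huv'
      exact Or.inr ⟨i', j', hij', fun hx => hn ((one huv' hl').2 hx),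
        (two huv huv' hl hl').1 hc⟩
  · intro hK u v huv
    obtain ⟨i, j, hij, hl⟩ := h.exists_coreEdge huv
    rcases hK i j hij with hc | ⟨i', j', hij', hn, hc⟩
    · exact Or.inl ((one huv hl).2 hc)
    · obtain ⟨u', v', huv', hl'⟩ := h.exists_edge hij'
      exact Or.inr ⟨u', v', huv', fun hx => hn ((one huv' hl').1 hx),
        (two huv huv' hl hl').2 hc⟩

/-- A leaf extension is obtained by attaching stars. -/
theorem exists_iso_attachStars [Finite V] (h : IsLeafExtension G K c S) :
    ∃ k : ι → ℕ, (∀ i, k i ≠ 0 ↔ S i) ∧ Nonempty (G ≃g attachStars K k) := by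
  let L : ι → Set V := fun i => {x | x ∉ Set.range c ∧ G.Adj x (c i)}
  let e : ∀ i, L i ≃ Fin (Nat.card (L i)) := fun i => Finite.equivFin (L i)
  let f : ι ⊕ (Σ i, Fin (Nat.card (L i))) → V := Sum.elim c fun x => ((e x.1).symm x.2 : V)
  have hmem : ∀ (i : ι) (j : Fin (Nat.card (L i))), ((e i).symm j : V) ∉ Set.range c ∧
      ∀ y, G.Adj ((e i).symm j) y ↔ y = c i := by
    intro i j
    have hp := ((e i).symm j).2
    obtain ⟨l, -, hl⟩ := h.leaf _ hp.1
    refine ⟨hp.1, ?_⟩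
    rw [(hl _).1 hp.2]
    exact hl
  have hf : Function.Bijective f := by
    constructor
    · rintro (i | ⟨i, a⟩) (j | ⟨j, b⟩) hij
      · rw [h.injective hij]
      · exact absurd ⟨i, hij⟩ (hmem j b).1
      · exact absurd ⟨j, hij.symm⟩ (hmem i a).1
      · have hij' : ((e i).symm a : V) = (e j).symm b := hij
        have : i = j := h.injective (((hmem j b).2 (c i)).1 (hij' ▸ ((hmem i a).2 (c i)).2 rfl))
        subst this
        rw [(e i).symm.injective (Subtype.ext hij')]
    · intro x
      by_cases hx : x ∈ Set.range c
      · obtain ⟨i, rfl⟩ := hx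
        exact ⟨Sum.inl i, rfl⟩
      · obtain ⟨i, -, hi⟩ := h.leaf x hx
        exact ⟨Sum.inr ⟨i, e i ⟨x, hx, (hi _).2 rfl⟩⟩,
          congrArg Subtype.val ((e i).symm_apply_apply _)⟩
  refine ⟨fun i => Nat.card (L i), fun i => ?_, ⟨RelIso.symm ⟨Equiv.ofBijective f hf, ?_⟩⟩⟩
  · rw [← Nat.pos_iff_ne_zero, Nat.card_pos_iff]
    constructor
    · rintro ⟨⟨x, hx, hxi⟩, -⟩
      obtain ⟨l, hS, hl⟩ := h.leaf x hx
      rwa [h.injective ((hl _).1 hxi)]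
    · intro hS
      obtain ⟨x, hx⟩ := h.exists_leaf i hS
      exact ⟨⟨x, hx⟩, inferInstance⟩
  · rintro (i | ⟨i, a⟩) (j | ⟨j, b⟩)
    · exact h.adj_iff i j
    · change G.Adj (c i) ((e j).symm b) ↔ j = i
      rw [G.adj_comm, (hmem j b).2, h.injective.eq_iff, eq_comm]
    · change G.Adj ((e i).symm a) (c j) ↔ i = j
      rw [(hmem i a).2, h.injective.eq_iff, eq_comm]
    · change G.Adj ((e i).symm a) ((e j).symm b) ↔ False
      rw [(hmem i a).2, iff_false]
      exact fun hx => (hmem j b).1 ⟨_, hx.symm⟩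

theorem nonempty_iso (h : IsLeafExtension G K c S) (hS : ∀ i, ¬ S i) : Nonempty (G ≃g K) := by
  have hb : Function.Bijective c := by
    refine ⟨h.injective, fun x => ?_⟩
    by_contra hx
    obtain ⟨i, hi, -⟩ := h.leaf x hx
    exact hS i hi
  exact ⟨RelIso.symm ⟨Equiv.ofBijective c hb, fun {i j} => h.adj_iff i j⟩⟩

theorem of_iso (e : G ≃g K) : IsLeafExtension G K e.symm fun _ => False where
  injective := e.symm.injective
  adj_iff _ _ := e.symm.map_adj_iff
  leaf x hx := absurd (e.symm.surjective x) hx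
  exists_leaf _ h := h.elim

theorem attachStars (K : SimpleGraph ι) (k : ι → ℕ) :
    IsLeafExtension (attachStars K k) K Sum.inl fun i => k i ≠ 0 where
  injective := Sum.inl_injective
  adj_iff _ _ := Iff.rfl
  leaf := by
    rintro (i | ⟨i, a⟩) hx
    · exact absurd ⟨i, rfl⟩ hx
    · refine ⟨i, fun h0 => (Fin.cast h0 a).elim0, ?_⟩
      rintro (j | ⟨j, b⟩)
      · exact ⟨fun h => congrArg Sum.inl (Eq.symm h), fun h => (Sum.inl_injective h).symm⟩
      · exact ⟨fun h => False.elim h, fun h => absurd h Sum.inr_ne_inl⟩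
  exists_leaf i hi := ⟨Sum.inr ⟨i, ⟨0, Nat.pos_of_ne_zero hi⟩⟩, by simp, rfl⟩

theorem comap_iso {W : Type*} {H : SimpleGraph W} (e : H ≃g G) (h : IsLeafExtension G K c S) :
    IsLeafExtension H K (e.symm ∘ c) S where
  injective := e.symm.injective.comp h.injective
  adj_iff i j := e.symm.map_adj_iff.trans (h.adj_iff i j)
  leaf x hx := by
    obtain ⟨i, hi, hl⟩ := h.leaf (e x) fun ⟨i, hi⟩ => hx ⟨i, by simp [hi]⟩
    refine ⟨i, hi, fun y => ?_⟩
    rw [← e.map_adj_iff, hl, Function.comp_apply, ← e.symm_apply_apply y, e.symm.injective.eq_iff]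
    simp
  exists_leaf i hi := by
    obtain ⟨x, hx, hxi⟩ := h.exists_leaf i hi
    refine ⟨e.symm x, ?_, e.symm.map_adj_iff.2 hxi⟩
    rintro ⟨j, hj⟩
    exact hx ⟨j, e.symm.injective hj⟩

end IsLeafExtension

/-! ### Finite checks on short cycles -/

section decisions

open SimpleGraph

theorem coreCondition_cycleGraph_three :
    ∀ S : Fin 3 → Bool, CoreCondition (cycleGraph 3) (fun i => S i) := by
  decide +kernel

theorem coreCondition_cycleGraph_four : ∀ S : Fin 4 → Bool,
    CoreCondition (cycleGraph 4) (fun i => S i) ↔ (Finset.univ.filter fun i => S i).card ≤ 2 := by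
  decide +kernel

theorem coreCondition_cycleGraph_five : ∀ S : Fin 5 → Bool,
    CoreCondition (cycleGraph 5) (fun i => S i) ↔ (Finset.univ.filter fun i => S i).card ≤ 1 := by
  decide +kernel

theorem coreCondition_cycleGraph_six : ∀ S : Fin 6 → Bool,
    CoreCondition (cycleGraph 6) (fun i => S i) ↔ (Finset.univ.filter fun i => S i).card = 0 := by
  decide +kernel

end decisions

/-! ### The unique cycle and the bridges outside it -/

/-- `c` runs through the vertices of a cycle of `G`, and every edge whose ends stay connected after
its deletion belongs to this cycle. -/
structure IsOnlyCycle {V : Type*} (G : SimpleGraph V) {m : ℕ} (c : Fin (m + 3) → V) : Prop where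
  injective : Function.Injective c
  adj_succ : ∀ i, G.Adj (c i) (c (i + 1))
  mem_of_reachable : ∀ u v, G.Adj u v → (G.deleteEdges {s(u, v)}).Reachable u v →
    ∃ i, s(c i, c (i + 1)) = s(u, v)

theorem IsUnicyclic.exists_isOnlyCycle {V : Type*} {G : SimpleGraph V} (hG : IsUnicyclic G) :
    ∃ (m : ℕ) (c : Fin (m + 3) → V), IsOnlyCycle G c := by
  obtain ⟨-, C, ⟨u, p, hp, hpC⟩, huniq⟩ := hG
  obtain ⟨m, hm⟩ := Nat.exists_eq_add_of_le' hp.three_le_length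
  -- At the last index `i + 1` wraps to 0, and the closed walk returns to its start.
  have hsucc : ∀ i : Fin (m + 3), p.getVert ((i + 1 : Fin (m + 3)) : ℕ) = p.getVert (i + 1) := by
    intro i
    rw [Fin.val_add_one]
    split_ifs with h
    · rw [p.getVert_zero, h, Fin.val_last, ← hm, p.getVert_length]
    · rfl
  refine ⟨m, fun i => p.getVert i, fun i j hij => ?_, fun i => ?_, fun v w hvw hr => ?_⟩
  · exact Fin.ext (hp.getVert_injOn' (by simp only [Set.mem_ofPred_eq]; omega)
      (by simp only [Set.mem_ofPred_eq]; omega) hij)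
  · rw [hsucc]
    exact p.adj_getVert_succ (by omega)
  · obtain ⟨x, q, hq, hmem⟩ :=
      SimpleGraph.adj_and_reachable_delete_edges_iff_exists_cycle.1 ⟨hvw, hr⟩
    have hqp : q.toSubgraph = p.toSubgraph := (huniq _ ⟨x, q, hq, rfl⟩).trans hpC.symm
    rw [← SimpleGraph.Walk.adj_toSubgraph_iff_mem_edges, hqp,
      SimpleGraph.Walk.toSubgraph_adj_iff] at hmem
    obtain ⟨i, hi, hlt⟩ := hmem
    exact ⟨⟨i, by omega⟩, by rw [hsucc]; exact hi⟩

/-- Deleting an edge of the cycle leaves a tree: that edge is not a bridge, and a surviving cycle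
would have to be the unique one, which contains it. -/
theorem IsUnicyclic.card_eq {V : Type*} [Fintype V] [DecidableEq V] {G : SimpleGraph V}
    [DecidableRel G.Adj] (hG : IsUnicyclic G) : Fintype.card V = G.edgeFinset.card := by
  obtain ⟨hconn, C, ⟨u, p, hp, hpC⟩, huniq⟩ := hG
  obtain ⟨e, he⟩ := List.exists_mem_of_ne_nil p.edges (by
    rw [← List.length_pos_iff, p.length_edges]
    have := hp.three_le_length
    omega)
  induction e with | h v w
  have hvw : s(v, w) ∈ G.edgeSet := p.edges_subset_edgeSet he
  have htree : (G.deleteEdges {s(v, w)}).IsTree := by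
    refine ⟨hconn.connected_delete_edge_of_not_isBridge fun hb =>
      hb.notMem_edges_of_isCycle hp he, fun x q hq => ?_⟩
    have hle := G.deleteEdges_le {s(v, w)}
    have hqp : (q.mapLe hle).toSubgraph = p.toSubgraph :=
      (huniq _ ⟨x, _, hq.mapLe hle, rfl⟩).trans hpC.symm
    have hmem : s(v, w) ∈ (q.mapLe hle).edges := by
      rw [← SimpleGraph.Walk.mem_edges_toSubgraph, hqp]
      exact p.mem_edges_toSubgraph.2 he
    rw [SimpleGraph.Walk.edges_mapLe_eq_edges] at hmem
    simpa using q.edges_subset_edgeSet hmem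
  classical
  have hcard := htree.card_edgeFinset
  have hdel : (G.deleteEdges {s(v, w)}).edgeFinset = G.edgeFinset.erase s(v, w) := by
    ext e
    simp [SimpleGraph.edgeSet_deleteEdges, and_comm]
  rw [hdel, Finset.card_erase_add_one (by simpa using hvw)] at hcard
  exact hcard.symm

namespace IsOnlyCycle

variable {V : Type*} {G : SimpleGraph V} {m : ℕ} {c : Fin (m + 3) → V}

/-- Allows the vertex where a branch is attached to be taken as `c 0`. -/
theorem rotate (h : IsOnlyCycle G c) (k : Fin (m + 3)) : IsOnlyCycle G fun i => c (i + k) where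
  injective := h.injective.comp (add_left_injective k)
  adj_succ i := by
    rw [add_right_comm]
    exact h.adj_succ (i + k)
  mem_of_reachable u v huv hr := by
    obtain ⟨i, hi⟩ := h.mem_of_reachable u v huv hr
    refine ⟨i - k, ?_⟩
    rwa [add_right_comm, sub_add_cancel]

theorem reachable_deleteEdges (h : IsOnlyCycle G c) {u v : V}
    (huv : ∀ i, s(c i, c (i + 1)) ≠ s(u, v)) (i j : Fin (m + 3)) :
    (G.deleteEdges {s(u, v)}).Reachable (c i) (c j) := by
  have h0 : ∀ i, (G.deleteEdges {s(u, v)}).Reachable (c 0) (c i) := by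
    intro i
    induction i using Fin.induction with
    | zero => rfl
    | succ i ih =>
      refine ih.trans (SimpleGraph.Adj.reachable ?_)
      rw [← Fin.coeSucc_eq_succ]
      exact SimpleGraph.deleteEdges_adj.2 ⟨h.adj_succ _, huv _⟩
  exact (h0 i).symm.trans (h0 j)

/-- An edge outside the cycle separates its ends. -/
theorem not_reachable (h : IsOnlyCycle G c) {u v : V} (huv : G.Adj u v)
    (hne : ∀ i, s(c i, c (i + 1)) ≠ s(u, v)) {i j : Fin (m + 3)}
    (hu : (G.deleteEdges {s(u, v)}).Reachable u (c i))
    (hv : (G.deleteEdges {s(u, v)}).Reachable v (c j)) : False := by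
  obtain ⟨l, hl⟩ := h.mem_of_reachable u v huv
    (hu.trans ((h.reachable_deleteEdges hne i j).trans hv.symm))
  exact hne l hl

theorem ne_of_notMem_range {x : V} (hx : x ∉ Set.range c) (y : V) (i : Fin (m + 3)) :
    s(c i, c (i + 1)) ≠ s(x, y) := by
  intro heq
  rcases Sym2.mem_iff.1 (heq ▸ Sym2.mem_mk_left x y : x ∈ s(c i, c (i + 1))) with hxi | hxi
  · exact hx ⟨_, hxi.symm⟩
  · exact hx ⟨_, hxi.symm⟩

/-- The cycle has no chord, since the ends of a chord stay connected along the cycle after its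
deletion. -/
theorem adj_iff (h : IsOnlyCycle G c) (i j : Fin (m + 3)) :
    G.Adj (c i) (c j) ↔ (SimpleGraph.cycleGraph (m + 3)).Adj i j := by
  rw [SimpleGraph.cycleGraph_adj (n := m + 1)]
  constructor
  · intro hij
    by_contra hn
    refine h.not_reachable hij (fun l hl => hn ?_) .rfl .rfl
    rw [Sym2.eq_iff] at hl
    simp only [h.injective.eq_iff] at hl
    rcases hl with ⟨rfl, rfl⟩ | ⟨rfl, rfl⟩
    · exact Or.inr (add_sub_cancel_left l 1)
    · exact Or.inl (add_sub_cancel_left l 1)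
  · rintro (hij | hij)
    · rw [sub_eq_iff_eq_add'] at hij
      exact hij ▸ (h.adj_succ j).symm
    · rw [sub_eq_iff_eq_add'] at hij
      exact hij ▸ h.adj_succ i

theorem eq_of_adj_of_adj (h : IsOnlyCycle G c) {x : V} (hx : x ∉ Set.range c) {i j : Fin (m + 3)}
    (hi : G.Adj x (c i)) (hj : G.Adj x (c j)) : i = j := by
  by_contra hij
  refine h.not_reachable hi (ne_of_notMem_range hx _) (i := j) (j := i) ?_ .rfl
  refine SimpleGraph.Adj.reachable (SimpleGraph.deleteEdges_adj.2 ⟨hj, ?_⟩)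
  rw [Set.mem_singleton_iff, Sym2.congr_right, h.injective.eq_iff]
  exact Ne.symm hij

theorem not_adj_of_adj_of_adj (h : IsOnlyCycle G c) {x y : V} (hx : x ∉ Set.range c)
    (hy : y ∉ Set.range c) {i j : Fin (m + 3)} (hi : G.Adj x (c i)) (hj : G.Adj y (c j)) :
    ¬ G.Adj x y := by
  intro hxy
  refine h.not_reachable hxy (ne_of_notMem_range hx _) (i := i) (j := j) ?_ ?_
  · refine SimpleGraph.Adj.reachable (SimpleGraph.deleteEdges_adj.2 ⟨hi, ?_⟩)
    rw [Set.mem_singleton_iff, Sym2.congr_right]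
    exact fun he => hy ⟨_, he⟩
  · refine SimpleGraph.Adj.reachable (SimpleGraph.deleteEdges_adj.2 ⟨hj, ?_⟩)
    rw [Set.mem_singleton_iff, Sym2.eq_swap, Sym2.congr_left]
    exact fun he => hx ⟨_, he⟩

/-- Otherwise `c i, w, x, y, c j` leaves and rejoins the cycle through the edge `xy`, although that
edge is a bridge; `i = j` is allowed. -/
theorem not_adj_of_path (h : IsOnlyCycle G c) {w x y : V}
    (hx : x ∉ Set.range c) (hy : y ∉ Set.range c) (hwy : w ≠ y) {i j : Fin (m + 3)}
    (hi : G.Adj w (c i)) (hj : G.Adj y (c j)) (hwx : G.Adj w x) : ¬ G.Adj x y := by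
  intro hxy
  refine h.not_reachable hxy (ne_of_notMem_range hx _) (i := i) (j := j) ?_ ?_
  · refine .trans (v := w) (SimpleGraph.Adj.reachable ?_) (SimpleGraph.Adj.reachable ?_)
    · refine SimpleGraph.deleteEdges_adj.2 ⟨hwx.symm, ?_⟩
      rw [Set.mem_singleton_iff, Sym2.congr_right]
      exact hwy
    · refine SimpleGraph.deleteEdges_adj.2 ⟨hi, ?_⟩
      rw [Set.mem_singleton_iff, Sym2.eq_iff]
      rintro (⟨-, he⟩ | ⟨-, he⟩)
      · exact hy ⟨_, he⟩
      · exact hx ⟨_, he⟩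
  · refine SimpleGraph.Adj.reachable (SimpleGraph.deleteEdges_adj.2 ⟨hj, ?_⟩)
    rw [Set.mem_singleton_iff, Sym2.eq_swap, Sym2.congr_left]
    exact fun he => hx ⟨_, he⟩

/-- If no vertex is at distance two from the cycle, the graph consists of the cycle and leaves. -/
theorem isLeafExtension (h : IsOnlyCycle G c) (hconn : G.Connected)
    (hdepth : ∀ w x i, w ∉ Set.range c → x ∉ Set.range c → G.Adj w (c i) → ¬ G.Adj w x) :
    IsLeafExtension G (SimpleGraph.cycleGraph (m + 3)) c
      (fun i => ∃ x, x ∉ Set.range c ∧ G.Adj x (c i)) where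
  injective := h.injective
  adj_iff := h.adj_iff
  exists_leaf _ hi := hi
  leaf := by
    -- Induction along a walk to the cycle: `hdepth` prevents the distance from ever reaching two.
    have hnear : ∀ x, x ∈ Set.range c ∨ ∃ i, G.Adj x (c i) := by
      suffices hwalk : ∀ x y, G.Walk x y → y ∈ Set.range c →
          x ∈ Set.range c ∨ ∃ i, G.Adj x (c i) from
        fun x => hwalk x (c 0) (hconn.preconnected x (c 0)).some ⟨0, rfl⟩
      intro x z p hz
      induction p with
      | nil => exact Or.inl hz
      | @cons x y _ hxy _ ih =>
        by_cases hx : x ∈ Set.range c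
        · exact Or.inl hx
        by_cases hy : y ∈ Set.range c
        · obtain ⟨i, rfl⟩ := hy
          exact Or.inr ⟨i, hxy⟩
        · obtain ⟨i, hi⟩ := (ih hz).resolve_left hy
          exact absurd hxy.symm (hdepth y x i hy hx hi)
    intro x hx
    obtain ⟨i, hi⟩ := (hnear x).resolve_left hx
    refine ⟨i, ⟨x, hx, hi⟩, fun y => ⟨fun hxy => ?_, fun hy => hy ▸ hi⟩⟩
    by_cases hy : y ∈ Set.range c
    · obtain ⟨j, rfl⟩ := hy
      rw [h.eq_of_adj_of_adj hx hxy hi]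
    · exact absurd hxy (hdepth x y i hx hy hi)

end IsOnlyCycle

/-! ### The paw and the numerical form of the checks -/

/-- The paw: a triangle `0, 1, 2` with a pendant vertex `3` at `0`. -/
def paw : SimpleGraph (Fin 4) :=
  SimpleGraph.fromRel fun i j => (i ≠ 3 ∧ j ≠ 3) ∨ i = 0

instance : DecidableRel paw.Adj := by
  unfold paw; infer_instance

/-- The two alternatives are the two ways to attach the double star: its leaves end up at the merged
vertex `0` or at the pendant vertex `3`. -/
theorem coreCondition_paw {S : Fin 4 → Prop} (h : (∀ i, S i → i = 0) ∨ ∀ i, S i → i = 3) :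
    CoreCondition paw S := by
  classical
  have hdec : ∀ S : Fin 4 → Bool, ((∀ i, S i → i = 0) ∨ ∀ i, S i → i = 3) →
      CoreCondition paw (fun i => S i) := by
    decide +kernel
  simpa using hdec (fun i => decide (S i)) (by simpa using h)

theorem coreCondition_three (k : Fin 3 → ℕ) :
    CoreCondition (SimpleGraph.cycleGraph 3) (fun i => k i ≠ 0) := by
  simpa using coreCondition_cycleGraph_three fun i => decide (k i ≠ 0)

theorem coreCondition_four_iff (k : Fin 4 → ℕ) :
    CoreCondition (SimpleGraph.cycleGraph 4) (fun i => k i ≠ 0) ↔ numAttached k ≤ 2 := by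
  simpa [numAttached] using coreCondition_cycleGraph_four fun i => decide (k i ≠ 0)

theorem coreCondition_five_iff (k : Fin 5 → ℕ) :
    CoreCondition (SimpleGraph.cycleGraph 5) (fun i => k i ≠ 0) ↔ numAttached k ≤ 1 := by
  simpa [numAttached] using coreCondition_cycleGraph_five fun i => decide (k i ≠ 0)

theorem coreCondition_six_iff (k : Fin 6 → ℕ) :
    CoreCondition (SimpleGraph.cycleGraph 6) (fun i => k i ≠ 0) ↔ numAttached k = 0 := by
  simpa [numAttached] using coreCondition_cycleGraph_six fun i => decide (k i ≠ 0)

theorem numAttached_eq_zero_iff {n : ℕ} (k : Fin n → ℕ) : numAttached k = 0 ↔ ∀ i, k i = 0 := by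
  simp [numAttached, Finset.filter_eq_empty_iff]

/-! ### Structure forced by the covering condition -/

namespace EdgePairCondition

variable {V : Type*} {G : SimpleGraph V}

/-- Two disjoint edges that avoid a third edge are joined by an edge. -/
theorem exists_adj (hG : EdgePairCondition G) {u v p q r s : V} (huv : G.Adj u v)
    (hpq : G.Adj p q) (hrs : G.Adj r s) (hp : p ≠ u ∧ p ≠ v) (hq : q ≠ u ∧ q ≠ v)
    (hr : r ≠ u ∧ r ≠ v) (hs : s ≠ u ∧ s ≠ v) (hpr : p ≠ r ∧ p ≠ s) (hqr : q ≠ r ∧ q ≠ s) :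
    G.Adj p r ∨ G.Adj p s ∨ G.Adj q r ∨ G.Adj q s := by
  -- Some edge `u'v'` completes `uv` to a cover. It must meet both `pq` and `rs`, which are
  -- disjoint, so it is itself the joining edge.
  obtain ⟨u', v', huv', hc⟩ : ∃ u' v', G.Adj u' v' ∧ G.IsVertexCover {u, v, u', v'} := by
    rcases hG u v huv with h | ⟨u', v', h', -, h⟩
    · exact ⟨u, v, huv, h.subset (by simp)⟩
    · exact ⟨u', v', h', h⟩
  have h1 := hc hpq
  have h2 := hc hrs
  have huv'' := huv'.symm
  simp only [Set.mem_insert_iff, Set.mem_singleton_iff, hp.1, hp.2, hq.1, hq.2, hr.1, hr.2, hs.1,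
    hs.2, false_or] at h1 h2
  rcases h1 with (rfl | rfl) | (rfl | rfl) <;> rcases h2 with (rfl | rfl) | (rfl | rfl) <;>
    simp_all

variable {m : ℕ} {c : Fin (m + 3) → V}

/-- On seven consecutive vertices of a longer cycle, the edges 01, 23, 56 are disjoint and no edge
joins 23 to 56; with exactly seven vertices, 6 is adjacent to 0 but not to 2 or 3. -/
theorem lt_four (hG : EdgePairCondition G) (hc : IsOnlyCycle G c) : m < 4 := by
  by_contra hm
  obtain ⟨l, rfl⟩ := Nat.exists_eq_add_of_le' (not_lt.1 hm)
  have hlt : ∀ i : Fin 7, (i : ℕ) < l + 4 + 3 := fun i => by omega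
  let d : Fin 7 → V := fun i => c ⟨i, hlt i⟩
  have hd : ∀ i j, i ≠ j → d i ≠ d j := fun i j hij h =>
    hij (Fin.ext (Fin.mk.inj_iff.1 (hc.injective h)))
  have hsucc : ∀ i j : Fin 7, (i : ℕ) + 1 = j → G.Adj (d i) (d j) := by
    intro i j hij
    rw [hc.adj_iff, SimpleGraph.cycleGraph_adj']
    have hle : (⟨i, hlt i⟩ : Fin (l + 4 + 3)) ≤ ⟨j, hlt j⟩ := Fin.mk_le_mk.2 (by omega)
    right
    rw [Fin.sub_val_of_le hle]
    simp only
    omega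
  have hnot : ∀ i j : Fin 7, (i : ℕ) + 2 ≤ j → (j : ℕ) ≤ i + 4 → ¬ G.Adj (d i) (d j) := by
    intro i j hij hij'
    have hlt : (⟨i, hlt i⟩ : Fin (l + 4 + 3)) < ⟨j, hlt j⟩ := Fin.mk_lt_mk.2 (by omega)
    rw [hc.adj_iff, SimpleGraph.cycleGraph_adj', Fin.sub_val_of_le hlt.le,
      Fin.coe_sub_iff_lt.2 hlt]
    simp only
    omega
  rcases hG.exists_adj (hsucc 0 1 rfl) (hsucc 2 3 rfl) (hsucc 5 6 rfl)
    ⟨hd _ _ (by decide), hd _ _ (by decide)⟩ ⟨hd _ _ (by decide), hd _ _ (by decide)⟩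
    ⟨hd _ _ (by decide), hd _ _ (by decide)⟩ ⟨hd _ _ (by decide), hd _ _ (by decide)⟩
    ⟨hd _ _ (by decide), hd _ _ (by decide)⟩ ⟨hd _ _ (by decide), hd _ _ (by decide)⟩
    with h | h | h | h
  · exact hnot 2 5 (by decide) (by decide) h
  · exact hnot 2 6 (by decide) (by decide) h
  · exact hnot 3 5 (by decide) (by decide) h
  · exact hnot 3 6 (by decide) (by decide) h

/-- `hm` supplies disjoint cycle edges, one of them at `c i`. The other cannot be joined to `wx`:
`w` has no cycle neighbour but `c i`, and `x` has none. A triangle fails `hm`. -/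
theorem not_adj_of_notMem_range (hG : EdgePairCondition G) (hc : IsOnlyCycle G c)
    (hm : ∀ i : Fin (m + 3), ∃ i' j j', (SimpleGraph.cycleGraph (m + 3)).Adj i i' ∧
      (SimpleGraph.cycleGraph (m + 3)).Adj j j' ∧ (j ≠ i ∧ j ≠ i') ∧ (j' ≠ i ∧ j' ≠ i'))
    (w x : V) (i : Fin (m + 3)) (hw : w ∉ Set.range c) (hx : x ∉ Set.range c)
    (hwi : G.Adj w (c i)) : ¬ G.Adj w x := by
  intro hwx
  obtain ⟨i', j, j', hi, hj, hji, hji'⟩ := hm i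
  have hne : ∀ {y}, y ∉ Set.range c → ∀ l, y ≠ c l := fun hy l hl => hy ⟨l, hl.symm⟩
  have hxl : ∀ l, ¬ G.Adj (c l) x := fun l hl =>
    hc.not_adj_of_adj_of_adj hw hx hwi hl.symm hwx
  have hwl : ∀ l, l ≠ i → ¬ G.Adj (c l) w := fun l hli hl =>
    hli (hc.eq_of_adj_of_adj hw hl.symm hwi)
  rcases hG.exists_adj ((hc.adj_iff _ _).2 hi) ((hc.adj_iff _ _).2 hj) hwx
    ⟨hc.injective.ne hji.1, hc.injective.ne hji.2⟩
    ⟨hc.injective.ne hji'.1, hc.injective.ne hji'.2⟩ ⟨hne hw _, hne hw _⟩ ⟨hne hx _, hne hx _⟩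
    ⟨(hne hw _).symm, (hne hx _).symm⟩ ⟨(hne hw _).symm, (hne hx _).symm⟩ with h | h | h | h
  · exact hwl _ hji.1 h
  · exact hxl _ h
  · exact hwl _ hji'.1 h
  · exact hxl _ h

/-- In a unicyclic graph with a triangle and a vertex `x` at distance two from it, everything
outside the triangle hangs at one vertex. -/
theorem isLeafExtension_paw (hG : EdgePairCondition G) {c : Fin (0 + 3) → V}
    (hc : IsOnlyCycle G c) (hconn : G.Connected) {w x : V} (hw : w ∉ Set.range c)
    (hx : x ∉ Set.range c) (hw0 : G.Adj w (c 0)) (hwx : G.Adj w x) :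
    IsLeafExtension G paw ![c 0, c 1, c 2, w] (fun i => i = 3) := by
  have hne : ∀ {y}, y ∉ Set.range c → ∀ l, y ≠ c l := fun hy l hl => hy ⟨l, hl.symm⟩
  have hxl : ∀ l, ¬ G.Adj (c l) x := fun l hl =>
    hc.not_adj_of_adj_of_adj hw hx hw0 hl.symm hwx
  have hwl : ∀ l, l ≠ 0 → ¬ G.Adj (c l) w := fun l hl0 hl =>
    hl0 (hc.eq_of_adj_of_adj hw hl.symm hw0)
  have hcc : ∀ i j, i ≠ j → G.Adj (c i) (c j) := by
    intro i j hij
    rw [hc.adj_iff]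
    revert i j
    decide
  have hthird : ∀ i : Fin (0 + 3), i ≠ 0 → ∃ j : Fin (0 + 3), j ≠ 0 ∧ i ≠ j := by decide
  -- Apply `exists_adj` to `c i y`, `w x` and the triangle edge avoiding `c i`; each possible join
  -- would put a bridge on a cycle.
  have hbare : ∀ i, i ≠ 0 → ∀ y, y ∉ Set.range c → ¬ G.Adj (c i) y := by
    intro i hi y hy hiy
    have hyw : y ≠ w := by
      rintro rfl
      exact hwl i hi hiy
    have hyx : y ≠ x := by
      rintro rfl
      exact hxl i hiy
    obtain ⟨j, hj, hij⟩ := hthird i hi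
    rcases hG.exists_adj (hcc 0 j hj.symm) hiy hwx
      ⟨hc.injective.ne hi, hc.injective.ne hij⟩ ⟨hne hy _, hne hy _⟩ ⟨hne hw _, hne hw _⟩
      ⟨hne hx _, hne hx _⟩ ⟨(hne hw _).symm, (hne hx _).symm⟩ ⟨hyw, hyx⟩ with h | h | h | h
    · exact hwl i hi h
    · exact hxl i h
    · exact hc.not_adj_of_adj_of_adj hy hw hiy.symm hw0 h
    · exact hc.not_adj_of_path hx hy hyw.symm hw0 hiy.symm hwx h.symm
  -- A second branch `y` at `c 0` would make `c 0 y`, `c 1 c 2`, `w x` disjoint, while `hbare`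
  -- forbids joining the last two.
  have hzero : ∀ y, y ∉ Set.range c → G.Adj (c 0) y → y = w := by
    intro y hy h0y
    by_contra hyw
    have hyx : y ≠ x := by
      rintro rfl
      exact hxl 0 h0y
    rcases hG.exists_adj h0y (hcc 1 2 (by decide)) hwx
      ⟨hc.injective.ne (by decide), (hne hy _).symm⟩
      ⟨hc.injective.ne (by decide), (hne hy _).symm⟩ ⟨hne hw _, Ne.symm hyw⟩
      ⟨hne hx _, hyx.symm⟩ ⟨(hne hw _).symm, (hne hx _).symm⟩
      ⟨(hne hw _).symm, (hne hx _).symm⟩ with h | h | h | h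
    · exact hbare 1 (by decide) w hw h
    · exact hbare 1 (by decide) x hx h
    · exact hbare 2 (by decide) w hw h
    · exact hbare 2 (by decide) x hx h
  -- Here the disjoint edges are `w c 0`, `c 1 c 2` and `y z`.
  have hfar : ∀ y z, y ∉ Set.range c → z ∉ Set.range c → y ≠ w → z ≠ w → ¬ G.Adj y z := by
    intro y z hy hz hyw hzw hyz
    rcases hG.exists_adj hw0 (hcc 1 2 (by decide)) hyz
      ⟨(hne hw _).symm, hc.injective.ne (by decide)⟩
      ⟨(hne hw _).symm, hc.injective.ne (by decide)⟩ ⟨hyw, hne hy _⟩ ⟨hzw, hne hz _⟩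
      ⟨(hne hy _).symm, (hne hz _).symm⟩ ⟨(hne hy _).symm, (hne hz _).symm⟩ with h | h | h | h
    · exact hbare 1 (by decide) y hy h
    · exact hbare 1 (by decide) z hz h
    · exact hbare 2 (by decide) y hy h
    · exact hbare 2 (by decide) z hz h
  have hrange : ∀ y, y ∉ Set.range ![c 0, c 1, c 2, w] → y ∉ Set.range c ∧ y ≠ w := by
    intro y hy
    refine ⟨?_, fun h => hy ⟨3, h.symm⟩⟩
    rintro ⟨i, rfl⟩
    fin_cases i
    · exact hy ⟨0, rfl⟩
    · exact hy ⟨1, rfl⟩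
    · exact hy ⟨2, rfl⟩
  have honly : ∀ y, y ∉ Set.range ![c 0, c 1, c 2, w] → ∀ z, G.Adj y z → z = w := by
    intro y hy z hyz
    obtain ⟨hy, hyw⟩ := hrange y hy
    by_contra hzw
    by_cases hz : z ∈ Set.range c
    · obtain ⟨i, rfl⟩ := hz
      by_cases hi : i = 0
      · exact hyw (hzero y hy (hi ▸ hyz.symm))
      · exact hbare i hi y hy hyz.symm
    · exact hfar y z hy hz hyw hzw hyz
  refine ⟨?_, ?_, ?_, ?_⟩
  · have h01 := (hcc 0 1 (by decide)).ne
    have h02 := (hcc 0 2 (by decide)).ne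
    have h12 := (hcc 1 2 (by decide)).ne
    have h0 := hne hw 0
    have h1 := hne hw 1
    have h2 := hne hw 2
    intro i j hij
    fin_cases i <;> fin_cases j <;> first
      | rfl
      | exact absurd hij h01
      | exact absurd hij.symm h01
      | exact absurd hij h02
      | exact absurd hij.symm h02
      | exact absurd hij h12
      | exact absurd hij.symm h12
      | exact absurd hij h0
      | exact absurd hij.symm h0
      | exact absurd hij h1
      | exact absurd hij.symm h1
      | exact absurd hij h2
      | exact absurd hij.symm h2
  · intro i j
    have h01 := hcc 0 1 (by decide)
    have h02 := hcc 0 2 (by decide)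
    have h12 := hcc 1 2 (by decide)
    have h1 := hbare 1 (by decide) w hw
    have h2 := hbare 2 (by decide) w hw
    fin_cases i <;> fin_cases j <;> first
      | exact iff_of_true h01 (by decide)
      | exact iff_of_true h01.symm (by decide)
      | exact iff_of_true h02 (by decide)
      | exact iff_of_true h02.symm (by decide)
      | exact iff_of_true h12 (by decide)
      | exact iff_of_true h12.symm (by decide)
      | exact iff_of_true hw0 (by decide)
      | exact iff_of_true hw0.symm (by decide)
      | exact iff_of_false h1 (by decide)
      | exact iff_of_false (fun h => h1 h.symm) (by decide)
      | exact iff_of_false h2 (by decide)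
      | exact iff_of_false (fun h => h2 h.symm) (by decide)
      | exact iff_of_false (G.irrefl) (by decide)
  · intro y hy
    refine ⟨3, rfl, fun z => ⟨honly y hy z, ?_⟩⟩
    intro hz
    rw [hz]
    change G.Adj y w
    -- The first step of a walk from `y` to `w` must already end at `w`, by `honly`.
    cases (hconn.preconnected y w).some with
    | nil => exact absurd rfl (hrange _ hy).2
    | cons hyz _ => exact (honly y hy _ hyz) ▸ hyz
  · rintro i rfl
    refine ⟨x, ?_, hwx.symm⟩
    rintro ⟨i, hi⟩
    fin_cases i
    · exact hx ⟨0, hi⟩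
    · exact hx ⟨1, hi⟩
    · exact hx ⟨2, hi⟩
    · exact hwx.ne hi

end EdgePairCondition

/-! ### Triangles with a double star as extensions of the paw -/

/-- The vertices of the paw in a triangle with a double star attached at `v` by its center `a`. -/
def pawVertex (p : ℕ) (v : Fin 3) (a b : Fin 2) (hab : b ≠ a) :
    Fin 4 → Fin 3 ⊕ {y : Fin 2 ⊕ (Σ i : Fin 2, Fin (![p, 0] i)) // y ≠ Sum.inl a} :=
  ![Sum.inl v, Sum.inl (v + 1), Sum.inl (v + 2), Sum.inr ⟨Sum.inl b, by simpa using hab⟩]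

/-- The double-star centre `b` that is not merged becomes the pendant vertex `3`. All `p` leaves
hang at centre `0`, which is the merged vertex if `a = 0` and the pendant one otherwise. -/
theorem isLeafExtension_identifyVertices (p : ℕ) (v : Fin 3) (a b : Fin 2) (hab : b ≠ a) :
    IsLeafExtension
      (identifyVertices (SimpleGraph.cycleGraph 3) v (doubleStar p 0) (Sum.inl a)) paw
      (pawVertex p v a b hab) (fun i => p ≠ 0 ∧ i = if a = 0 then 0 else 3) where
  injective := by
    intro i j hij
    fin_cases v <;> fin_cases i <;> fin_cases j <;> simp_all [pawVertex]
  adj_iff i j := by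
    fin_cases v <;> fin_cases a <;> fin_cases b <;> fin_cases i <;> fin_cases j <;>
      simp [pawVertex, identifyVertices, doubleStar, attachStars, paw,
        SimpleGraph.cycleGraph_three_eq_top] at hab ⊢
  leaf := by
    rintro (i | ⟨i | ⟨i, x⟩, hy⟩) hx
    · have hi : i = v ∨ i = v + 1 ∨ i = v + 2 := by
        clear hx
        revert i v
        decide
      rcases hi with rfl | rfl | rfl
      · exact absurd ⟨0, rfl⟩ hx
      · exact absurd ⟨1, rfl⟩ hx
      · exact absurd ⟨2, rfl⟩ hx
    · have hi : i = b := by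
        have hia : i ≠ a := fun h => hy (h ▸ rfl)
        clear hx hy
        revert i a b
        decide
      subst hi
      exact absurd ⟨3, rfl⟩ hx
    · have hi : i = 0 := by
        by_contra hi
        obtain rfl : i = 1 := by omega
        exact x.elim0
      subst hi
      have hp : p ≠ 0 := fun h => (Fin.cast h x).elim0
      refine ⟨_, ⟨hp, rfl⟩, ?_⟩
      obtain ⟨rfl, rfl⟩ | ⟨rfl, rfl⟩ : (a = 0 ∧ b = 1) ∨ (a = 1 ∧ b = 0) := by omega
      · rintro (j | ⟨j | ⟨j, y⟩, hj⟩)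
        · exact ⟨fun h => congrArg Sum.inl h.1, fun h => ⟨Sum.inl_injective h, rfl⟩⟩
        · exact ⟨fun h => absurd (congrArg Sum.inl (Eq.symm h)) hj, fun h => absurd h Sum.inr_ne_inl⟩
        · exact ⟨fun h => False.elim h, fun h => absurd h Sum.inr_ne_inl⟩
      · rintro (j | ⟨j | ⟨j, y⟩, hj⟩)
        · exact ⟨fun h => absurd h.2 (by change ¬ (0 : Fin 2) = 1; decide),
            fun h => absurd h Sum.inl_ne_inr⟩
        · refine ⟨fun h => ?_, fun h => ?_⟩
          · obtain rfl : 0 = j := h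
            rfl
          · exact (Sum.inl_injective (congrArg Subtype.val (Sum.inr_injective h))).symm
        · exact ⟨fun h => False.elim h,
            fun h => absurd (congrArg Subtype.val (Sum.inr_injective h)) Sum.inr_ne_inl⟩
  exists_leaf := by
    rintro i ⟨hp, rfl⟩
    refine ⟨Sum.inr ⟨Sum.inr ⟨0, ⟨0, Nat.pos_of_ne_zero hp⟩⟩, Sum.inr_ne_inl⟩, ?_, ?_⟩
    · rintro ⟨i, hi⟩
      fin_cases i <;> simp [pawVertex] at hi
    · fin_cases a <;> fin_cases b <;>
        simp [pawVertex, identifyVertices, doubleStar, attachStars] at hab ⊢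

theorem IsLeafExtension.exists_iso_identifyVertices {V : Type*} [Finite V] {G : SimpleGraph V}
    {c : Fin 4 → V} (h : IsLeafExtension G paw c (fun i => i = 3)) :
    ∃ p, Nonempty (G ≃g
      identifyVertices (SimpleGraph.cycleGraph 3) 0 (doubleStar p 0) (Sum.inl 1)) := by
  obtain ⟨k, hk, ⟨e⟩⟩ := h.exists_iso_attachStars
  have hk3 : k 3 ≠ 0 := (hk 3).2 rfl
  obtain ⟨k', hk', ⟨e'⟩⟩ := (isLeafExtension_identifyVertices (k 3) 0 1 0
    (by decide)).exists_iso_attachStars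
  -- The count `k'` is not explicit, but it vanishes off `3`, so comparing numbers of vertices gives
  -- `k' 3 = k 3`.
  have hcard := Fintype.card_congr e'.toEquiv
  have hk0 : ∀ i, i ≠ 3 → k i = 0 := fun i hi => by
    by_contra h
    exact hi ((hk i).1 h)
  have hk0' : ∀ i, i ≠ 3 → k' i = 0 := fun i hi => by
    by_contra h
    exact hi (by simpa using ((hk' i).1 h).2)
  have hsum : ∑ i, k' i = k' 3 := Finset.sum_eq_single 3 (fun i _ hi => hk0' i hi) (by simp)
  have heq : k' = k := by
    funext i
    by_cases hi : i = 3
    · subst hi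
      simp [Fintype.card_subtype_compl, hsum] at hcard
      omega
    · rw [hk0 i hi, hk0' i hi]
  rw [heq] at e'
  exact ⟨k 3, ⟨e.trans e'.symm⟩⟩

/-! ### The covering condition characterizes Θ -/

theorem EdgePairCondition.of_inTheta {V : Type*} {G : SimpleGraph V} (h : InTheta G) :
    EdgePairCondition G := by
  have hstars : ∀ {n : ℕ} {k : Fin n → ℕ},
      CoreCondition (SimpleGraph.cycleGraph n) (fun i => k i ≠ 0) →
      (G ≃g attachStars (SimpleGraph.cycleGraph n) k) → EdgePairCondition G := fun hc e =>
    ((IsLeafExtension.attachStars _ _).comap_iso e).edgePairCondition_iff.2 hc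
  rcases h with ⟨n, h3, h6, ⟨e⟩⟩ | ⟨k, -, ⟨e⟩⟩ | ⟨p, v, a, ⟨e⟩⟩ | ⟨k, hk, ⟨e⟩⟩ | ⟨k, hk, ⟨e⟩⟩
  · refine (IsLeafExtension.of_iso e).edgePairCondition_iff.2 ?_
    interval_cases n
    · simpa using coreCondition_three 0
    · simpa using (coreCondition_four_iff 0).2 (by simp [numAttached])
    · simpa using (coreCondition_five_iff 0).2 (by simp [numAttached])
    · simpa using (coreCondition_six_iff 0).2 (by simp [numAttached])
  · exact hstars (coreCondition_three k) e
  -- In `Fin 2`, `1 - a` is the other centre.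
  · refine ((isLeafExtension_identifyVertices p v a (1 - a)
      (by clear e; revert a; decide)).comap_iso e).edgePairCondition_iff.2 (coreCondition_paw ?_)
    by_cases ha : a = 0
    · exact Or.inl fun i hi => by simpa [ha] using hi.2
    · exact Or.inr fun i hi => by simpa [ha] using hi.2
  · exact hstars ((coreCondition_four_iff k).2 (by omega)) e
  · exact hstars ((coreCondition_five_iff k).2 (by omega)) e

theorem EdgePairCondition.inTheta {V : Type*} [Finite V] {G : SimpleGraph V}
    (h : EdgePairCondition G) (hG : IsUnicyclic G) : InTheta G := by
  obtain ⟨m, c, hc⟩ := hG.exists_isOnlyCycle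
  have hm := h.lt_four hc
  have hstars : (∀ w x i, w ∉ Set.range c → x ∉ Set.range c → G.Adj w (c i) → ¬ G.Adj w x) →
      ∃ k : Fin (m + 3) → ℕ, Nonempty (G ≃g attachStars (SimpleGraph.cycleGraph (m + 3)) k) ∧
        (numAttached k = 0 → Nonempty (G ≃g SimpleGraph.cycleGraph (m + 3))) ∧
        CoreCondition (SimpleGraph.cycleGraph (m + 3)) (fun i => k i ≠ 0) := by
    intro hdepth
    have hl := hc.isLeafExtension hG.1 hdepth
    obtain ⟨k, hk, he⟩ := hl.exists_iso_attachStars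
    refine ⟨k, he, fun h0 => hl.nonempty_iso fun i hi => (hk i).2 hi
      ((numAttached_eq_zero_iff k).1 h0 i), ?_⟩
    rw [funext fun i => propext (hk i)]
    exact hl.edgePairCondition_iff.1 h
  interval_cases m
  · by_cases hdepth : ∀ w x i, w ∉ Set.range c → x ∉ Set.range c → G.Adj w (c i) → ¬ G.Adj w x
    · obtain ⟨k, he, h0, -⟩ := hstars hdepth
      by_cases hk : numAttached k = 0
      · exact Or.inl ⟨3, by omega, by omega, h0 hk⟩
      · exact Or.inr (Or.inl ⟨k, by omega, he⟩)
    · push Not at hdepth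
      obtain ⟨w, x, i, hw, hx, hwi, hwx⟩ := hdepth
      have hr : Set.range (fun j => c (j + i)) = Set.range c :=
        (add_right_surjective i).range_comp c
      obtain ⟨p, he⟩ := (h.isLeafExtension_paw (hc.rotate i) hG.1 (hr ▸ hw) (hr ▸ hx)
        (by simpa using hwi) hwx).exists_iso_identifyVertices
      -- Only the leafless centre `1` is needed: merging centre `0` just attaches a star with `p +
      -- 1` leaves, as in (b).
      exact Or.inr (Or.inr (Or.inl ⟨p, 0, 1, he⟩))
  · obtain ⟨k, he, h0, hk⟩ := hstars (h.not_adj_of_notMem_range hc (by decide))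
    have hk := (coreCondition_four_iff k).1 hk
    by_cases hk0 : numAttached k = 0
    · exact Or.inl ⟨4, by omega, by omega, h0 hk0⟩
    · exact Or.inr (Or.inr (Or.inr (Or.inl ⟨k, by omega, he⟩)))
  · obtain ⟨k, he, h0, hk⟩ := hstars (h.not_adj_of_notMem_range hc (by decide))
    have hk := (coreCondition_five_iff k).1 hk
    by_cases hk0 : numAttached k = 0
    · exact Or.inl ⟨5, by omega, by omega, h0 hk0⟩
    · exact Or.inr (Or.inr (Or.inr (Or.inr ⟨k, by omega, he⟩)))
  · obtain ⟨k, he, h0, hk⟩ := hstars (h.not_adj_of_notMem_range hc (by decide))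
    exact Or.inl ⟨6, by omega, by omega, h0 ((coreCondition_six_iff k).1 hk)⟩

theorem mainTheorem1 {V : Type*} [Fintype V] [DecidableEq V] (G : SimpleGraph V)
    [DecidableRel G.Adj] (hG : IsUnicyclic G) :
    Fintype.card V = G.edgeFinset.card ∧
    (edgeCoalitionNumber G = G.edgeFinset.card ↔ InTheta G) ∧
    (IsECPartition G (singletonEdgePartition G) ↔ InTheta G) := by
  have hiff : IsECPartition G (singletonEdgePartition G) ↔ InTheta G :=
    (isECPartition_singleton_iff G).trans ⟨fun h => h.inTheta hG, .of_inTheta⟩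
  have hne : Nonempty V := hG.1.nonempty
  refine ⟨hG.card_eq, (edgeCoalitionNumber_eq_iff G ?_).trans hiff, hiff⟩
  rw [← hG.card_eq]
  exact Fintype.card_pos
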